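/- Let $q$ be a power of $2$, let $f\in\mathbb{F}_q[x]$ have degree $3$, and let $E$ be the elliptic curve $y^2+y=f(x)$ over $\mathbb{F}_q$, with point at infinity $O$. Let $k\ge 3$ and $n=2k$. Let $T$ be a finite set of $x$-coordinates of $\mathbb{F}_q$-rational points of $E$ other than $O$, and suppose that the rational points $\neq O$ of $E$ with $x$-coordinate in $T$ are exactly $n$ distinct points $P_i=(\alpha_i,\beta_i)$, $1\le i\le n$; put $D=P_1+\cdots+P_n$. Let $t=\prod_{\alpha\in T}(x-\alpha)$, $\omega=dx/t$ and $\gamma_i=\mathrm{res}_{P_i}(\omega)$. Let $\eta\in\mathbb{F}_q^*$ and $\mathbf{v}=(v_1,\dots,v_n)\in(\mathbb{F}_q^*)^n$. Put $\ell=\frac{k-3}{2}$ if $k$ is odd and $\ell=\frac{k}{2}$ if $k$ is even. Let $S_\ell$ be the space of functions $$\sum_{i=0}^{(k-1)/2}a_ix^i+\sum_{j=0}^{(k-3)/2}b_jx^jy+b_\ell\,\eta\, x^{(k+1)/2}\quad (k\text{ odd}),\qquad \sum_{i=0}^{k/2}a_ix^i+\sum_{j=0}^{(k-4)/2}b_jx^jy+a_\ell\,\eta\,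 x^{(k-2)/2}y\quad (k\text{ even}),$$ with all $a_i,b_j\in\mathbb{F}_q$, and let $\mathcal{C}(D,kO,\ell,\eta,\mathbf{v})=\{(v_1g(P_1),\dots,v_ng(P_n)) : g\in S_\ell\}\subseteq\mathbb{F}_q^n$ be the twisted generalized elliptic curve code. A code is self-dual if it equals its dual for the Euclidean inner product. Then: 1. If $k$ is odd, $\mathcal{C}(D,kO,\ell,\eta,\mathbf{v})$ is self-dual if and only if $\sum_{i=1}^n\gamma_i\alpha_i^{k+1}=0$ and there is $\lambda\in\mathbb{F}_q^*$ such that $v_i^2=\lambda\gamma_i$ for all $i=1,\dots,n$. 2. If $k$ is even, $\mathcal{C}(D,kO,\ell,\eta,\mathbf{v})$ is self-dual if and only if $\sum_{i=1}^n\gamma_i\alpha_i^{k-2}\beta_i^2=0$ and there is $\lambda\in\mathbb{F}_q^*$ such that $v_i^2=\lambda\gamma_i$ for all $i=1,\dots,n$. -/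

import Mathlib

open Polynomial

noncomputable section

/-- An elliptic curve of the second type over `K` (of characteristic two): the curve with affine
equation `y² + y = f(x)`, where `f` is a polynomial of degree `3`, and one point `O` at infinity. -/
structure SecondTypeCurve (K : Type*) [Field K] where
  f : K[X]
  natDegree_f : f.natDegree = 3

namespace SecondTypeCurve

variable {K : Type*} [Field K] (E : SecondTypeCurve K)

/-- The defining polynomial `Y² + Y - f(X)`, as a polynomial in `Y` over `K[X]`. -/
def polynomial : K[X][X] := X ^ 2 + X - C E.f

theorem polynomial_eq_cubic : E.polynomial = (⟨0, 1, 1, -E.f⟩ : Cubic K[X]).toPoly := by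
  simp only [polynomial, Cubic.toPoly, C_0, C_1, C_neg]
  ring

theorem monic_polynomial : E.polynomial.Monic := by
  rw [polynomial_eq_cubic]
  exact Cubic.monic_of_b_eq_one'

theorem natDegree_polynomial : E.polynomial.natDegree = 2 := by
  rw [polynomial_eq_cubic]
  exact Cubic.natDegree_of_b_ne_zero' one_ne_zero

theorem degree_f : E.f.degree = 3 :=
  (degree_eq_iff_natDegree_eq_of_pos (by norm_num)).2 E.natDegree_f

theorem irreducible_polynomial : Irreducible E.polynomial := by
  by_contra h
  rcases (E.monic_polynomial.not_irreducible_iff_exists_add_mul_eq_coeff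
    E.natDegree_polynomial).mp h with ⟨g, h, h0, h1⟩
  simp only [polynomial_eq_cubic, Cubic.coeff_eq_c, Cubic.coeff_eq_d] at h0 h1
  apply_fun degree at h0 h1
  rw [degree_neg, E.degree_f, degree_mul] at h0
  rw [degree_one] at h1
  apply (h1.symm.le).not_gt
  rcases Nat.WithBot.add_eq_three_iff.mp h0.symm with h | h | h | h
  iterate 2 rw [degree_add_eq_right_of_degree_lt] <;> simp only [h] <;> decide
  iterate 2 rw [degree_add_eq_left_of_degree_lt] <;> simp only [h] <;> decide

/-- The ring `K[x, y]` of functions on the curve that are regular away from `O`. -/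
abbrev CoordinateRing : Type _ := AdjoinRoot E.polynomial

instance : IsDomain E.CoordinateRing :=
  AdjoinRoot.isDomain_of_prime E.irreducible_polynomial.prime

/-- The elliptic function field `K(x, y)` of the curve. -/
abbrev FunctionField : Type _ := FractionRing E.CoordinateRing

/-- The coordinate function `x`. -/
def xFun : E.CoordinateRing := AdjoinRoot.of E.polynomial X

/-- The coordinate function `y`. -/
def yFun : E.CoordinateRing := AdjoinRoot.root E.polynomial

/-- The constant function with value `c`. -/
def const (c : K) : E.CoordinateRing := AdjoinRoot.of E.polynomial (C c)

/-- The rational points of the curve other than `O`. -/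
@[ext] structure Point where
  x : K
  y : K
  equation : y ^ 2 + y = E.f.eval x

variable {E}

/-- The value of a function at a rational point. -/
def evalAt (P : E.Point) : E.CoordinateRing →+* K :=
  AdjoinRoot.lift (evalRingHom P.x) P.y <| by
    simp [polynomial, P.equation]

theorem aeval_translate_injective (a : K) : Function.Injective
    (aeval (PowerSeries.C a + PowerSeries.X : PowerSeries K) : K[X] →ₐ[K] PowerSeries K) := by
  have h : (aeval (PowerSeries.C a + PowerSeries.X : PowerSeries K) : K[X] →ₐ[K] PowerSeries K)
      = (coeToPowerSeries.algHom K).comp (taylorAlgHom a) := by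
    ext1
    simp [coeToPowerSeries.algHom_apply, add_comm]
  rw [h]
  intro p q hpq
  have hpq' : ((taylor a p : K[X]) : PowerSeries K) = (taylor a q : K[X]) := by
    simpa [coeToPowerSeries.algHom_apply] using hpq
  exact taylor_injective a (Polynomial.coe_injective K hpq')

section Residue

variable [CharP K 2]

/-- At a rational point `(α, β)` the function `x - α` is a local uniformizer: there is exactly one
power series `Y` in `T` with constant coefficient `β` that solves `Y² + Y = f(α + T)`. -/
theorem existsUnique_branch (P : E.Point) : ∃! Y : PowerSeries K,
    PowerSeries.constantCoeff Y = P.y ∧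
      Y ^ 2 + Y = aeval (PowerSeries.C P.x + PowerSeries.X : PowerSeries K) E.f := by
  set g : PowerSeries K := aeval (PowerSeries.C P.x + PowerSeries.X : PowerSeries K) E.f with hg
  have h2 : (2 : K) = 0 := CharTwo.two_eq_zero
  have hg0 : PowerSeries.constantCoeff g = E.f.eval P.x := by
    rw [hg, aeval_def, hom_eval₂]
    have : (PowerSeries.constantCoeff (R := K)).comp (algebraMap K (PowerSeries K))
        = RingHom.id K := by
      ext a
      simp
    rw [this]
    simp [eval₂_id]
  have hmem (a : PowerSeries K) : a ∈ Ideal.span {(PowerSeries.X : PowerSeries K)} ↔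
      PowerSeries.constantCoeff a = 0 := by
    rw [Ideal.mem_span_singleton, PowerSeries.X_dvd_iff]
  obtain ⟨Y, hY, hY0⟩ := HenselianRing.is_henselian
    (I := Ideal.span {(PowerSeries.X : PowerSeries K)})
    (X ^ 2 + X - C g : (PowerSeries K)[X])
    (by
      have : (X ^ 2 + X - C g : (PowerSeries K)[X])
          = (⟨0, 1, 1, -g⟩ : Cubic (PowerSeries K)).toPoly := by
        simp only [Cubic.toPoly, C_0, C_1, C_neg]
        ring
      rw [this]
      exact Cubic.monic_of_b_eq_one')
    (PowerSeries.C P.y)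
    (by
      rw [hmem]
      simp [hg0, P.equation])
    (by
      apply RingHom.isUnit_map
      rw [PowerSeries.isUnit_iff_constantCoeff]
      have h3 : (1 + 1 : K) = 0 := by rw [one_add_one_eq_two, h2]
      simp [h3])
  have hYc : PowerSeries.constantCoeff Y = P.y := by
    rw [hmem] at hY0
    simpa [sub_eq_zero] using hY0
  have hYe : Y ^ 2 + Y = g := by
    simpa [IsRoot.def, sub_eq_zero] using hY
  refine ⟨Y, ⟨hYc, hYe⟩, ?_⟩
  rintro Z ⟨hZc, hZe⟩
  have hmul : (Z - Y) * (Z + Y + 1) = 0 := by linear_combination hZe - hYe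
  rcases mul_eq_zero.1 hmul with h | h
  · exact sub_eq_zero.1 h
  · have := congrArg (PowerSeries.constantCoeff (R := K)) h
    simp only [map_add, hZc, hYc, map_one, map_zero] at this
    exact absurd this (by rw [← two_mul, h2]; simp)

/-- The expansion of the function `y` at `P = (α, β)` in powers of `T = x - α`. -/
def branch (P : E.Point) : PowerSeries K := (existsUnique_branch P).choose

theorem branch_equation (P : E.Point) : branch P ^ 2 + branch P =
    aeval (PowerSeries.C P.x + PowerSeries.X : PowerSeries K) E.f :=
  (existsUnique_branch P).choose_spec.1.2

/-- The expansion at `P = (α, β)`, in powers of `T = x - α`, of the functions in `K[x, y]`. -/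
def powerExpansion (P : E.Point) : E.CoordinateRing →+* PowerSeries K :=
  AdjoinRoot.lift
    (aeval (PowerSeries.C P.x + PowerSeries.X : PowerSeries K) : K[X] →ₐ[K] PowerSeries K).toRingHom
    (branch P) <| by
      simp [polynomial, branch_equation P]

theorem powerExpansion_injective (P : E.Point) : Function.Injective (powerExpansion P) := by
  rw [RingHom.injective_iff_ker_eq_bot]
  have := E.monic_polynomial.finite_adjoinRoot
  apply Ideal.eq_bot_of_comap_eq_bot (R := K[X])
  rw [eq_bot_iff]
  intro p hp
  have h0 : powerExpansion P (AdjoinRoot.of E.polynomial p) = 0 := hp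
  rw [powerExpansion, AdjoinRoot.lift_of] at h0
  exact (Ideal.mem_bot).2 (aeval_translate_injective P.x (h0.trans (map_zero _).symm))

/-- The `P`-adic expansion of the functions in `K(x, y)`, as Laurent series in the local
uniformizer `T = x - α` at `P = (α, β)`. -/
def expansion (P : E.Point) : E.FunctionField →+* LaurentSeries K :=
  IsFractionRing.lift (A := E.CoordinateRing)
    (g := (HahnSeries.ofPowerSeries ℤ K).comp (powerExpansion P))
    (HahnSeries.ofPowerSeries_injective.comp (powerExpansion_injective P))

/-- The residue at `P = (α, β)` of the differential `u dx = u d(x - α)`: the coefficient of `T⁻¹`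
in the expansion of `u` in the local uniformizer `T = x - α`. -/
def residue (P : E.Point) (u : E.FunctionField) : K := (expansion P u).coeff (-1)

/-- The function `t = ∏_{α ∈ S} (x - α)`. -/
def tFun (E : SecondTypeCurve K) (S : Finset K) : E.CoordinateRing :=
  ∏ α ∈ S, (E.xFun - E.const α)

/-- The residue at `P` of the differential `ω = dx / t`, where `t = ∏_{α ∈ S} (x - α)`. -/
def gammaRes (S : Finset K) (P : E.Point) : K :=
  residue P (algebraMap E.CoordinateRing E.FunctionField (E.tFun S))⁻¹

end Residue

/-- For odd `k` and `0 ≤ l ≤ (k - 3) / 2`, the set of all functions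
`∑_{i ≤ (k-1)/2} aᵢ xⁱ + ∑_{j ≤ (k-3)/2} bⱼ xʲ y + b_l η x^{(k+1)/2}`. -/
def oddDefiningSet (E : SecondTypeCurve K) (k l : ℕ) (η : K) : Set E.CoordinateRing :=
  {g | ∃ a b : ℕ → K,
    g = ∑ i ∈ Finset.range ((k - 1) / 2 + 1), E.const (a i) * E.xFun ^ i
      + ∑ j ∈ Finset.range ((k - 3) / 2 + 1), E.const (b j) * E.xFun ^ j * E.yFun
      + E.const (b l * η) * E.xFun ^ ((k + 1) / 2)}

/-- For even `k ≥ 4` and `0 ≤ l ≤ k / 2`, the set of all functions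
`∑_{i ≤ k/2} aᵢ xⁱ + ∑_{j ≤ (k-4)/2} bⱼ xʲ y + a_l η x^{(k-2)/2} y`. -/
def evenDefiningSet (E : SecondTypeCurve K) (k l : ℕ) (η : K) : Set E.CoordinateRing :=
  {g | ∃ a b : ℕ → K,
    g = ∑ i ∈ Finset.range (k / 2 + 1), E.const (a i) * E.xFun ^ i
      + ∑ j ∈ Finset.range ((k - 4) / 2 + 1), E.const (b j) * E.xFun ^ j * E.yFun
      + E.const (a l * η) * E.xFun ^ ((k - 2) / 2) * E.yFun}

/-- The defining set `S_l` with one twist, for `k ≥ 3`. -/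
def definingSet (E : SecondTypeCurve K) (k l : ℕ) (η : K) : Set E.CoordinateRing :=
  {g | (Odd k ∧ g ∈ E.oddDefiningSet k l η) ∨ (Even k ∧ g ∈ E.evenDefiningSet k l η)}

/-- The twisted generalized elliptic curve code `𝒞(D, kO, l, η, v)`, where `D` is the sum of
the points `P i`. -/
def tgecc {n : ℕ} (P : Fin n → E.Point) (k l : ℕ) (η : K) (v : Fin n → K) : Set (Fin n → K) :=
  {c | ∃ g ∈ E.definingSet k l η, c = fun i => v i * evalAt (P i) g}

end SecondTypeCurve

/-- The dual of a code of length `n` for the Euclidean inner product. -/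
def dualCode {K : Type*} [Field K] {n : ℕ} (c : Set (Fin n → K)) : Set (Fin n → K) :=
  {a | ∀ b ∈ c, ∑ i, a i * b i = 0}

/-- A code is self-dual if it equals its Euclidean dual. -/
def IsSelfDualCode {K : Type*} [Field K] {n : ℕ} (c : Set (Fin n → K)) : Prop :=
  c = dualCode c

end

noncomputable section

namespace SecondTypeCurve

variable {K : Type*} [Field K] {E : SecondTypeCurve K}

/-! The points over `S` come in pairs `(α, β)`, `(α, β + 1)`, so `#S = k`, and `γ` is the Lagrange
nodal weight of `α`, the same at both. In characteristic two `A + B y` sums over a pair to `B(α)`;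
Lagrange interpolation then gives `∑ γᵢ (A + B y)(Pᵢ) = [x^(k-1)] B` when `deg B < k`
(`sum_gammaRes_mul_eval`). Hence the sum conditions in both parts always hold, and only `v² = c γ`
matters.

Sufficiency: in a product of two functions of the defining space the coefficient of `y` has degree
below `k - 1`, because the symmetric form that computes its top coefficient is alternating and the
twist confines the top coefficients to one line (`mulSnd_degree_lt_and_coeff_eq`). So the code is
self-orthogonal, of dimension `k = n / 2`.

Necessity: orthogonality says that the weights `v²` kill all such products. These force `∑ vᵢ² A(αᵢ)
= 0` for every `A` and `∑ vᵢ² αᵢ^j βᵢ = 0` for `j < k - 1`. The weights `γ` obey the same relations,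
and these determine a weight vector up to a scalar (`weight_eq_zero`). `isSelfDualCode_image_iff`
packages both directions. -/

@[simp] theorem evalAt_of (Q : E.Point) (p : K[X]) :
    evalAt Q (AdjoinRoot.of E.polynomial p) = p.eval Q.x := by
  simp [evalAt]

@[simp] theorem evalAt_const (Q : E.Point) (c : K) : evalAt Q (E.const c) = c := by
  simp [const]

@[simp] theorem evalAt_xFun (Q : E.Point) : evalAt Q E.xFun = Q.x := by
  simp [xFun]

@[simp] theorem evalAt_yFun (Q : E.Point) : evalAt Q E.yFun = Q.y := by
  simp [yFun, evalAt]

/-! ### Conjugate points and the residues of `dx / t`. -/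

section CharTwo

variable [CharP K 2]

/-- The other rational point with the same `x`-coordinate. -/
def conjPoint (Q : E.Point) : E.Point where
  x := Q.x
  y := Q.y + 1
  equation := by
    have h2 : (2 : K) = 0 := CharTwo.two_eq_zero
    linear_combination Q.equation + (Q.y + 1) * h2

theorem y_eq_or_of_x_eq {Q R : E.Point} (h : Q.x = R.x) : Q.y = R.y ∨ Q.y = R.y + 1 := by
  have h2 : (2 : K) = 0 := CharTwo.two_eq_zero
  have hQ := Q.equation
  rw [h, ← R.equation] at hQ
  have : (Q.y - R.y) * (Q.y - (R.y + 1)) = 0 := by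
    linear_combination hQ - (R.y * Q.y - R.y ^ 2 - R.y + Q.y) * h2
  exact (mul_eq_zero.1 this).imp sub_eq_zero.1 sub_eq_zero.1

theorem powerExpansion_xFun_sub_const (Q : E.Point) (a : K) :
    powerExpansion Q (E.xFun - E.const a) = PowerSeries.C (Q.x - a) + PowerSeries.X := by
  have : E.xFun - E.const a = AdjoinRoot.of E.polynomial (X - C a) := by
    simp [xFun, const]
  rw [this, powerExpansion, AdjoinRoot.lift_of]
  simp only [AlgHom.toRingHom_eq_coe, RingHom.coe_coe, map_sub, aeval_X, aeval_C]
  rw [PowerSeries.algebraMap_apply, Algebra.algebraMap_self, RingHom.id_apply]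
  ring

/-- At `Q` one has `t = T u` with `u` a unit of constant term `∏ (α - a)` over `a ≠ α`, so the
residue is `u(0)⁻¹`. The branch of `y` plays no role. -/
theorem gammaRes_eq_nodalWeight [DecidableEq K] {S : Finset K} (Q : E.Point) (hQ : Q.x ∈ S) :
    gammaRes S Q = Lagrange.nodalWeight S id Q.x := by
  set u : PowerSeries K := ∏ a ∈ S.erase Q.x, (PowerSeries.C (Q.x - a) + PowerSeries.X) with hu
  have hexp : powerExpansion Q (E.tFun S) = PowerSeries.X * u := by
    simp only [tFun, map_prod, powerExpansion_xFun_sub_const]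
    rw [← Finset.mul_prod_erase S _ hQ]
    simp [hu]
  have hu0 : PowerSeries.constantCoeff u = ∏ a ∈ S.erase Q.x, (Q.x - a) := by
    simp [hu, map_prod]
  have hu1 : PowerSeries.constantCoeff u ≠ 0 := by
    rw [hu0, Finset.prod_ne_zero_iff]
    exact fun a ha => sub_ne_zero.2 (Finset.ne_of_mem_erase ha).symm
  have hinv : expansion Q (algebraMap E.CoordinateRing E.FunctionField (E.tFun S))⁻¹
      = HahnSeries.single (-1 : ℤ) (1 : K) * HahnSeries.ofPowerSeries ℤ K u⁻¹ := by
    rw [map_inv₀, expansion, IsFractionRing.lift_algebraMap, RingHom.comp_apply, hexp]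
    apply inv_eq_of_mul_eq_one_right
    rw [map_mul, HahnSeries.ofPowerSeries_X]
    calc _ = (HahnSeries.single (1 : ℤ) (1 : K) * HahnSeries.single (-1 : ℤ) (1 : K)) *
        (HahnSeries.ofPowerSeries ℤ K (u * u⁻¹)) := by rw [map_mul]; ring
      _ = 1 := by
        rw [PowerSeries.mul_inv_cancel _ hu1, HahnSeries.single_mul_single]
        simp
  rw [gammaRes, residue, hinv]
  have := HahnSeries.coeff_single_mul_add (r := (1 : K))
    (x := HahnSeries.ofPowerSeries ℤ K u⁻¹) (a := (0 : ℤ)) (b := (-1 : ℤ))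
  rw [zero_add, one_mul] at this
  rw [this]
  have h0 := HahnSeries.ofPowerSeries_apply_coeff (Γ := ℤ) (R := K) u⁻¹ 0
  rw [Nat.cast_zero] at h0
  rw [h0, PowerSeries.coeff_zero_eq_constantCoeff_apply, PowerSeries.constantCoeff_inv, hu0,
    Lagrange.nodalWeight, Finset.prod_inv_distrib]
  rfl

end CharTwo

/-! ### Sums and interpolation over the pairs of conjugate points. -/

section Points

variable [CharP K 2] {S : Finset K} {n : ℕ} {P : Fin n → E.Point}

theorem exists_fiber_eq_pair [DecidableEq K] (hS : ∀ α ∈ S, ∃ Q : E.Point, Q.x = α)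
    (hP : Function.Injective P) (hD : ∀ Q : E.Point, Q ∈ Set.range P ↔ Q.x ∈ S)
    {α : K} (hα : α ∈ S) :
    ∃ i j, i ≠ j ∧ (P i).x = α ∧ (P j).x = α ∧ (P j).y = (P i).y + 1 ∧
      Finset.univ.filter (fun l => (P l).x = α) = {i, j} := by
  obtain ⟨Q, rfl⟩ := hS α hα
  obtain ⟨i, hi⟩ := (hD Q).2 hα
  obtain ⟨j, hj⟩ := (hD (conjPoint Q)).2 hα
  have hxj : (P j).x = Q.x := by rw [hj]; rfl
  have hyj : (P j).y = Q.y + 1 := by rw [hj]; rfl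
  refine ⟨i, j, ?_, by rw [hi], hxj, by rw [hyj, hi], ?_⟩
  · rintro rfl
    rw [hi] at hyj
    simp at hyj
  · ext l
    simp only [Finset.mem_filter, Finset.mem_univ, true_and, Finset.mem_insert,
      Finset.mem_singleton]
    constructor
    · intro h
      rcases y_eq_or_of_x_eq h with h' | h'
      · exact Or.inl (hP (by rw [hi]; exact Point.ext h h'))
      · exact Or.inr (hP (Point.ext (h.trans hxj.symm) (h'.trans hyj.symm)))
    · rintro (rfl | rfl)
      · rw [hi]
      · exact hxj

theorem length_eq_two_mul_card (hS : ∀ α ∈ S, ∃ Q : E.Point, Q.x = α)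
    (hP : Function.Injective P) (hD : ∀ Q : E.Point, Q ∈ Set.range P ↔ Q.x ∈ S) :
    n = 2 * S.card := by
  classical
  have h := Finset.card_eq_sum_card_fiberwise (s := (Finset.univ : Finset (Fin n))) (t := S)
    (f := fun i => (P i).x) (fun i _ => (hD _).1 ⟨i, rfl⟩)
  rw [Finset.sum_congr rfl (g := fun _ => 2), Finset.card_univ, Fintype.card_fin] at h
  · simpa [mul_comm] using h
  · intro α hα
    obtain ⟨i, j, hij, -, -, -, h⟩ := exists_fiber_eq_pair hS hP hD hα
    rw [h, Finset.card_pair hij]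

/-- Over `α` the two terms are `G + H β` and `G + H (β + 1)`; everything but one `H` occurs twice
and cancels. -/
theorem sum_add_mul_y (hS : ∀ α ∈ S, ∃ Q : E.Point, Q.x = α)
    (hP : Function.Injective P) (hD : ∀ Q : E.Point, Q ∈ Set.range P ↔ Q.x ∈ S) (G H : K → K) :
    ∑ i, (G (P i).x + H (P i).x * (P i).y) = ∑ α ∈ S, H α := by
  classical
  rw [← Finset.sum_fiberwise_of_maps_to (s := Finset.univ) (t := S) (g := fun i => (P i).x)
    (fun i _ => (hD _).1 ⟨i, rfl⟩)]
  refine Finset.sum_congr rfl fun α hα => ?_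
  obtain ⟨i, j, hij, hi, hj, hy, h⟩ := exists_fiber_eq_pair hS hP hD hα
  have h2 : (2 : K) = 0 := CharTwo.two_eq_zero
  rw [h, Finset.sum_pair hij, hi, hj, hy]
  linear_combination (G α + H α * (P i).y) * h2

/-- The residue theorem for `(A + B y) dx / t`. -/
theorem sum_gammaRes_mul_eval (hS : ∀ α ∈ S, ∃ Q : E.Point, Q.x = α)
    (hP : Function.Injective P) (hD : ∀ Q : E.Point, Q ∈ Set.range P ↔ Q.x ∈ S)
    (A : K[X]) {B : K[X]} (hB : B.degree < S.card) :
    ∑ i, gammaRes S (P i) * (A.eval (P i).x + B.eval (P i).x * (P i).y)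
      = B.coeff (S.card - 1) := by
  classical
  -- The top coefficient of the interpolant of `B` on `S` is the sum of `B(α)` times the nodal
  -- weights.
  rw [Lagrange.coeff_eq_sum (s := S) (v := id) Function.injective_id.injOn hB]
  calc _ = ∑ i, (Lagrange.nodalWeight S id (P i).x * A.eval (P i).x
        + Lagrange.nodalWeight S id (P i).x * B.eval (P i).x * (P i).y) := by
        refine Finset.sum_congr rfl fun i _ => ?_
        rw [gammaRes_eq_nodalWeight _ ((hD _).1 ⟨i, rfl⟩)]
        ring
    _ = ∑ α ∈ S, Lagrange.nodalWeight S id α * B.eval α :=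
        sum_add_mul_y hS hP hD (fun α => Lagrange.nodalWeight S id α * A.eval α)
          (fun α => Lagrange.nodalWeight S id α * B.eval α)
    _ = _ := by
        refine Finset.sum_congr rfl fun α _ => ?_
        simp only [Lagrange.nodalWeight, Finset.prod_inv_distrib, id]
        rw [div_eq_inv_mul]

/-- Subtracting the values at two conjugate points gives `B(α) = 0`, then `A(α) = 0`; the degrees
are too small for `#S` roots. -/
theorem eq_zero_of_eval_eq_zero (hS : ∀ α ∈ S, ∃ Q : E.Point, Q.x = α)
    (hP : Function.Injective P) (hD : ∀ Q : E.Point, Q ∈ Set.range P ↔ Q.x ∈ S)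
    {A B : K[X]} (hA : A.degree < S.card) (hB : B.degree < S.card)
    (h : ∀ i, A.eval (P i).x + B.eval (P i).x * (P i).y = 0) : A = 0 ∧ B = 0 := by
  classical
  have key : ∀ α ∈ S, A.eval α = 0 ∧ B.eval α = 0 := by
    intro α hα
    obtain ⟨i, j, hij, hi, hj, hy, -⟩ := exists_fiber_eq_pair hS hP hD hα
    have h1 := h i
    have h2 := h j
    rw [hi] at h1
    rw [hj, hy] at h2
    have hB0 : B.eval α = 0 := by linear_combination h2 - h1
    rw [hB0] at h1
    exact ⟨by simpa using h1, hB0⟩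
  exact ⟨eq_zero_of_degree_lt_of_eval_finset_eq_zero S hA fun α hα => (key α hα).1,
    eq_zero_of_degree_lt_of_eval_finset_eq_zero S hB fun α hα => (key α hα).2⟩

/-- A weight vector is determined by its inner products with the functions `A + B y`. -/
theorem weight_eq_zero (hP : Function.Injective P)
    (hD : ∀ Q : E.Point, Q ∈ Set.range P ↔ Q.x ∈ S) {w : Fin n → K}
    (hA : ∀ A : K[X], ∑ i, w i * A.eval (P i).x = 0)
    (hB : ∀ B : K[X], B.degree < S.card → ∑ i, w i * (B.eval (P i).x * (P i).y) = 0) :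
    w = 0 := by
  classical
  funext i
  have hi : (P i).x ∈ S := (hD _).1 ⟨i, rfl⟩
  set B := Lagrange.basis S id (P i).x
  have hdeg : B.degree < S.card := by
    rw [Lagrange.degree_basis Function.injective_id.injOn hi]
    have : 0 < S.card := Finset.card_pos.2 ⟨_, hi⟩
    exact_mod_cast Nat.sub_lt this one_pos
  -- The test function `B · (y + yᵢ + 1)` is `1` at `P i`, vanishes at its conjugate through the
  -- second factor, and at all other points through `B`.
  have h : ∑ l, w l * (B.eval (P l).x * ((P l).y + (P i).y + 1)) = 0 := by
    have h1 := hA (C ((P i).y + 1) * B)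
    have h2 := hB B hdeg
    rw [← add_zero (0 : K)]
    nth_rw 1 [← h1]
    rw [← h2, ← Finset.sum_add_distrib]
    refine Finset.sum_congr rfl fun l _ => ?_
    rw [eval_mul, eval_C]
    ring
  have h2 : (2 : K) = 0 := CharTwo.two_eq_zero
  rw [Finset.sum_eq_single i] at h
  · have hBi : B.eval (P i).x = 1 :=
      Lagrange.eval_basis_self (v := id) Function.injective_id.injOn hi
    rw [hBi] at h
    simp only [Pi.zero_apply]
    linear_combination h - w i * (P i).y * h2
  · intro l _ hl
    by_cases hx : (P l).x = (P i).x
    · rcases y_eq_or_of_x_eq hx with hy | hy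
      · exact absurd (hP (Point.ext hx hy)) hl
      · rw [hy]
        linear_combination (w l * B.eval (P l).x * ((P i).y + 1)) * h2
    · have : B.eval (P l).x = 0 :=
        Lagrange.eval_basis_of_ne (v := id) (s := S) (i := (P i).x) (j := (P l).x)
          (Ne.symm hx) ((hD _).1 ⟨l, rfl⟩)
      rw [this]
      ring
  · simp

end Points

end SecondTypeCurve

/-! ### Linear algebra: dual codes and functionals on polynomials. -/

/-- The dot product identifies the dual code with the annihilator of `C`, of dimension `n - dim C`,
so an inclusion of `C` in its dual is an equality. -/
theorem isSelfDualCode_of_selfOrthogonal {K : Type*} [Field K] {n : ℕ}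
    (C : Submodule K (Fin n → K)) (hC : ∀ a ∈ C, ∀ b ∈ C, ∑ i, a i * b i = 0)
    (hn : n ≤ 2 * Module.finrank K C) : IsSelfDualCode (C : Set (Fin n → K)) := by
  set W : Submodule K (Fin n → K) :=
    C.dualAnnihilator.map (dotProductEquiv K (Fin n)).symm.toLinearMap with hW
  have hmem (a : Fin n → K) : a ∈ W ↔ ∀ b ∈ C, ∑ i, a i * b i = 0 := by
    rw [hW, Submodule.mem_map_equiv, Submodule.mem_dualAnnihilator]
    rfl
  have hle : C ≤ W := fun a ha => (hmem a).2 (hC a ha)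
  have hdim : Module.finrank K W = n - Module.finrank K C := by
    have h1 := Subspace.finrank_add_finrank_dualAnnihilator_eq C
    have h2 : Module.finrank K W = Module.finrank K C.dualAnnihilator :=
      LinearEquiv.finrank_map_eq (dotProductEquiv K (Fin n)).symm _
    rw [Module.finrank_fin_fun] at h1
    omega
  have heq : C = W := Submodule.eq_of_le_of_finrank_le hle (by omega)
  ext a
  exact (SetLike.ext_iff.1 heq a).trans (hmem a)

theorem LinearMap.eq_zero_of_forall_X_pow {K : Type*} [Field K] {L : K[X] →ₗ[K] K} {m : ℕ}
    (h : ∀ i < m, L (X ^ i) = 0) {p : K[X]} (hp : p.degree < m) : L p = 0 := by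
  classical
  have hle : degreeLT K m ≤ LinearMap.ker L := by
    rw [degreeLT_eq_span_X_pow, Submodule.span_le]
    intro q hq
    obtain ⟨i, hi, rfl⟩ := Finset.mem_image.1 (Finset.mem_coe.1 hq)
    exact h i (Finset.mem_range.1 hi)
  exact hle (mem_degreeLT.2 hp)

theorem LinearMap.eq_zero_of_forall_X_pow_of_monic {K : Type*} [Field K] {L : K[X] →ₗ[K] K}
    {m : ℕ} (h : ∀ i < m, L (X ^ i) = 0) {t : K[X]} (ht : t.Monic) (htm : t.degree = m)
    (hLt : ∀ p, L (t * p) = 0) (p : K[X]) : L p = 0 := by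
  rw [← modByMonic_add_div p t, map_add, hLt, add_zero]
  exact LinearMap.eq_zero_of_forall_X_pow h (htm ▸ degree_modByMonic_lt p ht)

/-- The image under `T` of the pairs `(A, B)` with `deg A < p` and `deg B < q`. -/
def degreeLTMap {K : Type*} [Field K] (T : K[X] × K[X] →ₗ[K] K[X] × K[X]) (p q : ℕ) :
    Submodule K (K[X] × K[X]) :=
  LinearMap.range (T ∘ₗ (degreeLT K p).subtype.prodMap (degreeLT K q).subtype)

theorem mem_degreeLTMap {K : Type*} [Field K] {T : K[X] × K[X] →ₗ[K] K[X] × K[X]} {p q : ℕ}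
    {m : K[X] × K[X]} : m ∈ degreeLTMap T p q ↔
      ∃ A B : K[X], A.degree < p ∧ B.degree < q ∧ T (A, B) = m := by
  constructor
  · rintro ⟨⟨⟨A, hA⟩, ⟨B, hB⟩⟩, rfl⟩
    exact ⟨A, B, mem_degreeLT.1 hA, mem_degreeLT.1 hB, rfl⟩
  · rintro ⟨A, B, hA, hB, rfl⟩
    exact ⟨⟨⟨A, mem_degreeLT.2 hA⟩, ⟨B, mem_degreeLT.2 hB⟩⟩, rfl⟩

theorem finrank_degreeLTMap {K : Type*} [Field K] {T : K[X] × K[X] →ₗ[K] K[X] × K[X]}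
    (hT : Function.Injective T) (p q : ℕ) : Module.finrank K (degreeLTMap T p q) = p + q := by
  rw [degreeLTMap, LinearMap.finrank_range_of_inj]
  · rw [((degreeLTEquiv K p).prodCongr (degreeLTEquiv K q)).finrank_eq]
    simp
  · exact hT.comp (Function.Injective.prodMap Subtype.val_injective Subtype.val_injective)

/-! ### The self-duality criterion for a space of pairs `(A, B)`. -/

namespace SecondTypeCurve

variable {K : Type*} [Field K] {E : SecondTypeCurve K}

/-- The codeword of the function `A + B y`. -/
def pairEval {n : ℕ} (P : Fin n → E.Point) (v : Fin n → K) : K[X] × K[X] →ₗ[K] Fin n → K where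
  toFun m i := v i * (m.1.eval (P i).x + m.2.eval (P i).x * (P i).y)
  map_add' m m' := by
    funext i
    simp
    ring
  map_smul' c m := by
    funext i
    simp
    ring

theorem pairEval_apply {n : ℕ} (P : Fin n → E.Point) (v : Fin n → K) (m : K[X] × K[X])
    (i : Fin n) :
    pairEval P v m i = v i * (m.1.eval (P i).x + m.2.eval (P i).x * (P i).y) := rfl

/-- The coefficient of `y` in `(A + B y) (A' + B' y)`, in characteristic two. -/
def mulSnd (m m' : K[X] × K[X]) : K[X] := m.1 * m'.2 + m'.1 * m.2 + m.2 * m'.2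

/-- The part free of `y` in `(A + B y) (A' + B' y)`. -/
def mulFst (E : SecondTypeCurve K) (m m' : K[X] × K[X]) : K[X] := m.1 * m'.1 + m.2 * m'.2 * E.f

theorem pairEval_mul_pairEval [CharP K 2] {n : ℕ} (P : Fin n → E.Point) (v : Fin n → K)
    (m m' : K[X] × K[X]) (i : Fin n) :
    pairEval P v m i * pairEval P v m' i =
      v i ^ 2 * ((E.mulFst m m').eval (P i).x + (mulSnd m m').eval (P i).x * (P i).y) := by
  have h2 : (2 : K) = 0 := CharTwo.two_eq_zero
  simp only [pairEval_apply, mulFst, mulSnd, eval_add, eval_mul]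
  linear_combination
    v i ^ 2 * m.2.eval (P i).x * m'.2.eval (P i).x * ((P i).equation - (P i).y * h2)

/-- `hmul` feeds the residue formula and gives self-orthogonality. `hspan` says that the products of
elements of `M` span enough: two functionals that vanish jointly on them, the first also on
multiples of the vanishing polynomial of `S`, satisfy all relations known for `γ`. -/
theorem isSelfDualCode_image_iff [CharP K 2] {S : Finset K} {n : ℕ} {P : Fin n → E.Point}
    (hS : ∀ α ∈ S, ∃ Q : E.Point, Q.x = α) (hP : Function.Injective P)
    (hD : ∀ Q : E.Point, Q ∈ Set.range P ↔ Q.x ∈ S) (hn : 0 < n)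
    {v : Fin n → K} (hv : ∀ i, v i ≠ 0) (M : Submodule K (K[X] × K[X]))
    (hdeg : ∀ m ∈ M, m.1.degree < S.card ∧ m.2.degree < S.card)
    (hdim : Module.finrank K M = S.card)
    (hmul : ∀ m ∈ M, ∀ m' ∈ M,
      (mulSnd m m').degree < S.card ∧ (mulSnd m m').coeff (S.card - 1) = 0)
    (hspan : ∀ L₁ L₂ : K[X] →ₗ[K] K, (∀ t : K[X], t.Monic → t.degree = S.card →
        (∀ α ∈ S, t.eval α = 0) → ∀ p, L₁ (t * p) = 0) →
      (∀ m ∈ M, ∀ m' ∈ M, L₁ (E.mulFst m m') + L₂ (mulSnd m m') = 0) →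
      (∀ p, L₁ p = 0) ∧ ∀ j < S.card - 1, L₂ (X ^ j) = 0) :
    IsSelfDualCode (pairEval P v '' M) ↔
      ∃ c : K, c ≠ 0 ∧ ∀ i, v i ^ 2 = c * gammaRes S (P i) := by
  have hcard := length_eq_two_mul_card hS hP hD
  have hinj : Function.Injective ((pairEval P v).domRestrict M) := by
    rw [injective_iff_map_eq_zero]
    rintro ⟨m, hm⟩ h
    have h0 := eq_zero_of_eval_eq_zero hS hP hD (hdeg m hm).1 (hdeg m hm).2
      (fun i => (mul_eq_zero.1 (congrFun h i)).resolve_left (hv i))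
    exact Subtype.ext (Prod.ext h0.1 h0.2)
  constructor
  · intro h
    have horth : ∀ m ∈ M, ∀ m' ∈ M, ∑ i, v i ^ 2 * ((E.mulFst m m').eval (P i).x
        + (mulSnd m m').eval (P i).x * (P i).y) = 0 := by
      intro m hm m' hm'
      have hmem : pairEval P v m ∈ dualCode (pairEval P v '' M) := by
        have h' : pairEval P v '' M = dualCode (pairEval P v '' M) := h
        rw [← h']
        exact ⟨m, hm, rfl⟩
      have := hmem _ ⟨m', hm', rfl⟩
      rw [← this]
      exact Finset.sum_congr rfl fun i _ => (pairEval_mul_pairEval P v m m' i).symm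
    -- Orthogonality of the code becomes a relation between the moments of `v²` against the
    -- functions of `x` and those against `y` times functions of `x`.
    set L₁ : K[X] →ₗ[K] K := ∑ i, (v i ^ 2) • leval (P i).x with hL₁
    set L₂ : K[X] →ₗ[K] K := ∑ i, (v i ^ 2 * (P i).y) • leval (P i).x with hL₂
    have hL₁a (p : K[X]) : L₁ p = ∑ i, v i ^ 2 * p.eval (P i).x := by
      simp [hL₁, leval_apply]
    have hL₂a (p : K[X]) : L₂ p = ∑ i, v i ^ 2 * (p.eval (P i).x * (P i).y) := by
      simp only [hL₂, LinearMap.sum_apply, LinearMap.smul_apply, leval_apply, smul_eq_mul]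
      exact Finset.sum_congr rfl fun i _ => by ring
    obtain ⟨h₁, h₂⟩ := hspan L₁ L₂
      (fun t _ _ ht p => by
        rw [hL₁a]
        exact Finset.sum_eq_zero fun i _ => by
          rw [eval_mul, ht _ ((hD _).1 ⟨i, rfl⟩)]
          ring)
      (fun m hm m' hm' => by
        rw [hL₁a, hL₂a, ← Finset.sum_add_distrib, ← horth m hm m' hm']
        exact Finset.sum_congr rfl fun i _ => by ring)
    -- Since `∑ γᵢ αᵢ^(#S-1) βᵢ = 1`, this is the only scalar for which `v² - c γ` also kills
    -- `x^(#S-1) y`.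
    set c := L₂ (X ^ (S.card - 1)) with hc
    have hw : (fun i => v i ^ 2 - c * gammaRes S (P i)) = 0 := by
      refine weight_eq_zero hP hD (fun A => ?_) (fun B hB => ?_)
      · have e := sum_gammaRes_mul_eval hS hP hD A (B := 0)
          (by rw [degree_zero]; exact WithBot.bot_lt_coe _)
        simp only [eval_zero, zero_mul, add_zero, coeff_zero] at e
        simp only [sub_mul, Finset.sum_sub_distrib, mul_assoc]
        rw [← Finset.mul_sum, e, ← hL₁a, h₁]
        simp
      · have e := sum_gammaRes_mul_eval hS hP hD 0 hB
        simp only [eval_zero, zero_add] at e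
        simp only [sub_mul, Finset.sum_sub_distrib, mul_assoc c]
        rw [← Finset.mul_sum, e, ← hL₂a]
        have := LinearMap.eq_zero_of_forall_X_pow (L := L₂ - c • lcoeff K (S.card - 1))
          (m := S.card) (fun i hi => ?_) hB
        · simpa using this
        · rcases (Nat.le_sub_one_of_lt hi).lt_or_eq with h' | h'
          · simp [h₂ i h', coeff_X_pow, h'.ne']
          · simp [h', hc]
    have hvc (i : Fin n) : v i ^ 2 = c * gammaRes S (P i) := sub_eq_zero.1 (congrFun hw i)
    refine ⟨c, ?_, hvc⟩
    intro h0
    have := hvc ⟨0, hn⟩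
    rw [h0, zero_mul] at this
    exact hv _ (pow_eq_zero_iff two_ne_zero |>.1 this)
  · rintro ⟨c, -, hvc⟩
    rw [← Submodule.map_coe]
    refine isSelfDualCode_of_selfOrthogonal _ ?_ ?_
    · rintro _ ⟨m, hm, rfl⟩ _ ⟨m', hm', rfl⟩
      simp only [pairEval_mul_pairEval, hvc, mul_assoc]
      rw [← Finset.mul_sum, sum_gammaRes_mul_eval hS hP hD _ (hmul m hm m' hm').1,
        (hmul m hm m' hm').2, mul_zero]
    · have := LinearMap.finrank_range_of_inj hinj
      rw [LinearMap.range_domRestrict] at this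
      rw [this, hdim, hcard]

end SecondTypeCurve

/-! ### Polynomials as finite coefficient sums, and the two twisted spaces. -/

theorem Polynomial.coeff_sum_range_C_mul_X_pow {R : Type*} [Semiring R] (a : ℕ → R) (n l : ℕ) :
    (∑ i ∈ Finset.range n, C (a i) * X ^ i).coeff l = if l < n then a l else 0 := by
  simp [finsetSum_coeff, coeff_X_pow]

theorem Polynomial.degree_sum_range_C_mul_X_pow_lt {R : Type*} [Semiring R] (a : ℕ → R) (n : ℕ) :
    (∑ i ∈ Finset.range n, C (a i) * X ^ i).degree < (n : WithBot ℕ) := by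
  rw [degree_lt_iff_coeff_zero]
  intro l hl
  rw [coeff_sum_range_C_mul_X_pow, if_neg (not_lt.2 hl)]

theorem Polynomial.eq_sum_range_of_degree_lt {R : Type*} [Semiring R] {p : R[X]} {n : ℕ}
    (hp : p.degree < n) : p = ∑ i ∈ Finset.range n, C (p.coeff i) * X ^ i := by
  ext l
  rw [coeff_sum_range_C_mul_X_pow]
  split_ifs with h
  · rfl
  · exact (degree_lt_iff_coeff_zero _ _).1 hp l (not_lt.1 h)

namespace SecondTypeCurve

variable {K : Type*} [Field K] {E : SecondTypeCurve K}

/-- As `b < a`, the term `B B'` does not reach degree `a + b`, where the coefficient is `A_a B'_b +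
A'_a B_b`. In characteristic two this is the determinant of `(A_a, B_b)` and `(A'_a, B'_b)`, both on
the line spanned by `(c, d)`. -/
theorem mulSnd_degree_lt_and_coeff_eq [CharP K 2] {a b : ℕ} (hab : b < a) {c d : K}
    {m m' : K[X] × K[X]} (hm₁ : m.1.natDegree ≤ a) (hm₂ : m.2.natDegree ≤ b)
    (hm₁' : m'.1.natDegree ≤ a) (hm₂' : m'.2.natDegree ≤ b)
    (hc : d * m.1.coeff a = c * m.2.coeff b) (hc' : d * m'.1.coeff a = c * m'.2.coeff b)
    (hcd : c ≠ 0 ∨ d ≠ 0) :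
    (mulSnd m m').degree < (a + b + 1 : ℕ) ∧ (mulSnd m m').coeff (a + b) = 0 := by
  have h1 : (m.1 * m'.2).natDegree ≤ a + b := natDegree_mul_le_of_le hm₁ hm₂'
  have h2 : (m'.1 * m.2).natDegree ≤ a + b := natDegree_mul_le_of_le hm₁' hm₂
  have h3 : (m.2 * m'.2).natDegree < a + b :=
    (natDegree_mul_le_of_le hm₂ hm₂').trans_lt (by omega)
  constructor
  · have h := natDegree_add_le_of_degree_le (natDegree_add_le_of_degree_le h1 h2) h3.le
    exact degree_le_natDegree.trans_lt (by exact_mod_cast Nat.lt_succ_of_le h)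
  · have two : (2 : K) = 0 := CharTwo.two_eq_zero
    rw [mulSnd, coeff_add, coeff_add, coeff_mul_add_eq_of_natDegree_le hm₁ hm₂',
      coeff_mul_add_eq_of_natDegree_le hm₁' hm₂, coeff_eq_zero_of_natDegree_lt h3, add_zero]
    rcases hcd with h | h <;> apply (mul_eq_zero.1 ?_).resolve_left h
    · linear_combination (d * m.1.coeff a * m'.1.coeff a) * two
        - m.1.coeff a * hc' - m'.1.coeff a * hc
    · linear_combination m'.2.coeff b * hc + m.2.coeff b * hc'
        + (c * m.2.coeff b * m'.2.coeff b) * two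

/-- `(A, B) ↦ (A + η b x^{s + 2}, B)`, where `b` is the coefficient of `x^s` in `B`. -/
def oddTwist (s : ℕ) (η : K) : K[X] × K[X] →ₗ[K] K[X] × K[X] where
  toFun m := (m.1 + C (m.2.coeff s * η) * X ^ (s + 2), m.2)
  map_add' m m' := by
    ext1
    · simp only [Prod.fst_add, Prod.snd_add, coeff_add, add_mul, C_add]
      ring
    · rfl
  map_smul' c m := by
    ext1
    · simp only [Prod.smul_fst, Prod.smul_snd, smul_eq_C_mul, coeff_C_mul, C_mul, RingHom.id_apply]
      ring
    · rfl

theorem oddTwist_apply (s : ℕ) (η : K) (A B : K[X]) :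
    oddTwist s η (A, B) = (A + C (B.coeff s * η) * X ^ (s + 2), B) := rfl

theorem oddTwist_injective (s : ℕ) (η : K) : Function.Injective (oddTwist s η) := by
  rintro ⟨A, B⟩ ⟨A', B'⟩ h
  rw [oddTwist_apply, oddTwist_apply, Prod.mk.injEq] at h
  obtain ⟨h, rfl⟩ := h
  rw [add_right_cancel h]

/-- `(A, B) ↦ (A, B + η a x^{s + 1})`, where `a` is the coefficient of `x^{s + 2}` in `A`. -/
def evenTwist (s : ℕ) (η : K) : K[X] × K[X] →ₗ[K] K[X] × K[X] where
  toFun m := (m.1, m.2 + C (m.1.coeff (s + 2) * η) * X ^ (s + 1))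
  map_add' m m' := by
    ext1
    · rfl
    · simp only [Prod.fst_add, Prod.snd_add, coeff_add, add_mul, C_add]
      ring
  map_smul' c m := by
    ext1
    · rfl
    · simp only [Prod.smul_fst, Prod.smul_snd, smul_eq_C_mul, coeff_C_mul, C_mul, RingHom.id_apply]
      ring

theorem evenTwist_apply (s : ℕ) (η : K) (A B : K[X]) :
    evenTwist s η (A, B) = (A, B + C (A.coeff (s + 2) * η) * X ^ (s + 1)) := rfl

theorem evenTwist_injective (s : ℕ) (η : K) : Function.Injective (evenTwist s η) := by
  rintro ⟨A, B⟩ ⟨A', B'⟩ h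
  rw [evenTwist_apply, evenTwist_apply, Prod.mk.injEq] at h
  obtain ⟨rfl, h⟩ := h
  rw [add_right_cancel h]

/-- With `k = 2 s + 3` the twisted index `ℓ = s` is the top index of the `b_j`, so the twist reads
the top coefficient of `B`. -/
theorem tgecc_odd {n : ℕ} (P : Fin n → E.Point) (s : ℕ) (η : K) (v : Fin n → K) :
    tgecc P (2 * s + 3) s η v =
      pairEval P v '' degreeLTMap (oddTwist s η) (s + 2) (s + 1) := by
  have hodd : Odd (2 * s + 3) := ⟨s + 1, by ring⟩
  have e1 : (2 * s + 3 - 1) / 2 + 1 = s + 2 := by omega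
  have e2 : (2 * s + 3 - 3) / 2 + 1 = s + 1 := by omega
  have e3 : (2 * s + 3 + 1) / 2 = s + 2 := by omega
  ext c
  simp only [tgecc, definingSet, hodd, Nat.not_even_iff_odd.2 hodd, true_and, false_and, or_false,
    oddDefiningSet, e1, e2, e3, Set.mem_ofPred_eq, Set.mem_image, SetLike.mem_coe, mem_degreeLTMap]
  constructor
  · rintro ⟨_, ⟨a, b, rfl⟩, rfl⟩
    refine ⟨_, ⟨_, _, degree_sum_range_C_mul_X_pow_lt a (s + 2),
      degree_sum_range_C_mul_X_pow_lt b (s + 1), rfl⟩, ?_⟩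
    funext i
    rw [oddTwist_apply, pairEval_apply, coeff_sum_range_C_mul_X_pow, if_pos (Nat.lt_succ_self s)]
    simp only [eval_add, eval_finsetSum, eval_mul, eval_C, eval_pow, eval_X, map_add, map_sum,
      map_mul, map_pow, evalAt_const, evalAt_xFun, evalAt_yFun, Finset.sum_mul]
    ring
  · rintro ⟨_, ⟨A, B, hA, hB, rfl⟩, rfl⟩
    refine ⟨_, ⟨A.coeff, B.coeff, rfl⟩, ?_⟩
    funext i
    rw [oddTwist_apply, pairEval_apply]
    have hA' := congrArg (eval (P i).x) (eq_sum_range_of_degree_lt hA)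
    have hB' := congrArg (eval (P i).x) (eq_sum_range_of_degree_lt hB)
    simp only [eval_finsetSum, eval_mul, eval_C, eval_pow, eval_X] at hA' hB'
    simp only [eval_add, eval_mul, eval_C, eval_pow, eval_X, map_add, map_sum,
      map_mul, map_pow, evalAt_const, evalAt_xFun, evalAt_yFun, hA', hB', Finset.sum_mul]
    ring

/-- With `k = 2 s + 4` the twisted index `ℓ = s + 2` is the top index of the `a_i`. -/
theorem tgecc_even {n : ℕ} (P : Fin n → E.Point) (s : ℕ) (η : K) (v : Fin n → K) :
    tgecc P (2 * s + 4) (s + 2) η v =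
      pairEval P v '' degreeLTMap (evenTwist s η) (s + 3) (s + 1) := by
  have heven : Even (2 * s + 4) := ⟨s + 2, by ring⟩
  have e1 : (2 * s + 4) / 2 + 1 = s + 3 := by omega
  have e2 : (2 * s + 4 - 4) / 2 + 1 = s + 1 := by omega
  have e3 : (2 * s + 4 - 2) / 2 = s + 1 := by omega
  ext c
  simp only [tgecc, definingSet, heven, Nat.not_odd_iff_even.2 heven, true_and, false_and,
    false_or, evenDefiningSet, e1, e2, e3, Set.mem_ofPred_eq, Set.mem_image, SetLike.mem_coe,
    mem_degreeLTMap]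
  constructor
  · rintro ⟨_, ⟨a, b, rfl⟩, rfl⟩
    refine ⟨_, ⟨_, _, degree_sum_range_C_mul_X_pow_lt a (s + 3),
      degree_sum_range_C_mul_X_pow_lt b (s + 1), rfl⟩, ?_⟩
    funext i
    rw [evenTwist_apply, pairEval_apply, coeff_sum_range_C_mul_X_pow,
      if_pos (Nat.lt_succ_self (s + 2))]
    simp only [eval_add, eval_finsetSum, eval_mul, eval_C, eval_pow, eval_X, map_add, map_sum,
      map_mul, map_pow, evalAt_const, evalAt_xFun, evalAt_yFun, Finset.sum_mul, add_mul]
    ring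
  · rintro ⟨_, ⟨A, B, hA, hB, rfl⟩, rfl⟩
    refine ⟨_, ⟨A.coeff, B.coeff, rfl⟩, ?_⟩
    funext i
    rw [evenTwist_apply, pairEval_apply]
    have hA' := congrArg (eval (P i).x) (eq_sum_range_of_degree_lt hA)
    have hB' := congrArg (eval (P i).x) (eq_sum_range_of_degree_lt hB)
    simp only [eval_finsetSum, eval_mul, eval_C, eval_pow, eval_X] at hA' hB'
    simp only [eval_add, eval_mul, eval_C, eval_pow, eval_X, map_add, map_sum,
      map_mul, map_pow, evalAt_const, evalAt_xFun, evalAt_yFun, hA', hB', Finset.sum_mul, add_mul]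
    ring

theorem natDegree_le_of_degree_lt_succ {p : K[X]} {n : ℕ} (h : p.degree < (n + 1 : ℕ)) :
    p.natDegree ≤ n := by
  rw [natDegree_le_iff_coeff_eq_zero]
  exact fun N hN => (degree_lt_iff_coeff_zero _ _).1 h N hN

theorem degree_lt_of_natDegree_le {p : K[X]} {n m : ℕ} (h : p.natDegree ≤ n) (hnm : n < m) :
    p.degree < m :=
  degree_le_natDegree.trans_lt (by exact_mod_cast h.trans_lt hnm)

theorem bounds_oddTwist {s : ℕ} {η : K} {m : K[X] × K[X]}
    (hm : m ∈ degreeLTMap (oddTwist s η) (s + 2) (s + 1)) :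
    m.1.natDegree ≤ s + 2 ∧ m.2.natDegree ≤ s ∧ 1 * m.1.coeff (s + 2) = η * m.2.coeff s := by
  obtain ⟨A, B, hA, hB, rfl⟩ := mem_degreeLTMap.1 hm
  rw [oddTwist_apply]
  refine ⟨?_, natDegree_le_of_degree_lt_succ hB, ?_⟩
  · exact natDegree_add_le_of_degree_le ((natDegree_le_of_degree_lt_succ hA).trans (by omega))
      (natDegree_C_mul_X_pow_le _ _)
  · have : A.coeff (s + 2) = 0 := (degree_lt_iff_coeff_zero _ _).1 hA _ le_rfl
    simp only [coeff_add, this, coeff_C_mul, coeff_X_pow_self]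
    ring

theorem bounds_evenTwist {s : ℕ} {η : K} {m : K[X] × K[X]}
    (hm : m ∈ degreeLTMap (evenTwist s η) (s + 3) (s + 1)) :
    m.1.natDegree ≤ s + 2 ∧ m.2.natDegree ≤ s + 1 ∧
      η * m.1.coeff (s + 2) = 1 * m.2.coeff (s + 1) := by
  obtain ⟨A, B, hA, hB, rfl⟩ := mem_degreeLTMap.1 hm
  rw [evenTwist_apply]
  refine ⟨natDegree_le_of_degree_lt_succ hA, ?_, ?_⟩
  · exact natDegree_add_le_of_degree_le ((natDegree_le_of_degree_lt_succ hB).trans (by omega))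
      (natDegree_C_mul_X_pow_le _ _)
  · have : B.coeff (s + 1) = 0 := (degree_lt_iff_coeff_zero _ _).1 hB _ le_rfl
    simp only [coeff_add, this, coeff_C_mul, coeff_X_pow_self]
    ring

theorem degree_X_pow_lt {i n : ℕ} (h : i < n) : (X ^ i : K[X]).degree < n := by
  rw [degree_X_pow]
  exact_mod_cast h

theorem zero_degree_lt (n : ℕ) : (0 : K[X]).degree < n := by
  rw [degree_zero]
  exact WithBot.bot_lt_coe _

/-- The monic polynomial of degree `#S` that vanishes on `S`. -/
theorem exists_monic_vanishing (S : Finset K) :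
    ∃ t : K[X], t.Monic ∧ t.degree = S.card ∧ ∀ α ∈ S, t.eval α = 0 :=
  ⟨Lagrange.nodal S id, Lagrange.nodal_monic, Lagrange.degree_nodal,
    fun _ hα => Lagrange.eval_nodal_at_node (v := id) hα⟩

/-! ### The criterion applied to the odd and the even code. -/

theorem isSelfDualCode_tgecc_odd [CharP K 2] {S : Finset K}
    (hS : ∀ α ∈ S, ∃ Q : E.Point, Q.x = α) (s : ℕ) {P : Fin (2 * (2 * s + 3)) → E.Point}
    (hP : Function.Injective P) (hD : ∀ Q : E.Point, Q ∈ Set.range P ↔ Q.x ∈ S)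
    (η : K) {v : Fin (2 * (2 * s + 3)) → K} (hv : ∀ i, v i ≠ 0) :
    IsSelfDualCode (tgecc P (2 * s + 3) s η v) ↔
      ∃ c : K, c ≠ 0 ∧ ∀ i, v i ^ 2 = c * gammaRes S (P i) := by
  have hcard : S.card = 2 * s + 3 := by
    have := length_eq_two_mul_card hS hP hD
    omega
  rw [tgecc_odd]
  refine isSelfDualCode_image_iff hS hP hD (by omega) hv _ ?_ ?_ ?_ ?_
  · intro m hm
    obtain ⟨h1, h2, -⟩ := bounds_oddTwist hm
    rw [hcard]
    exact ⟨degree_lt_of_natDegree_le h1 (by omega), degree_lt_of_natDegree_le h2 (by omega)⟩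
  · rw [finrank_degreeLTMap (oddTwist_injective s η), hcard]
    ring
  · intro m hm m' hm'
    obtain ⟨h1, h2, h3⟩ := bounds_oddTwist hm
    obtain ⟨h1', h2', h3'⟩ := bounds_oddTwist hm'
    have := mulSnd_degree_lt_and_coeff_eq (by omega) h1 h2 h1' h2' h3 h3' (Or.inr one_ne_zero)
    rw [hcard]
    convert this using 3 <;> omega
  · intro L₁ L₂ ht h
    have hpow : ∀ i < s + 2, ((X ^ i, 0) : K[X] × K[X]) ∈
        degreeLTMap (oddTwist s η) (s + 2) (s + 1) := fun i hi =>
      mem_degreeLTMap.2 ⟨X ^ i, 0, degree_X_pow_lt hi, zero_degree_lt _, by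
        simp [oddTwist_apply]⟩
    have hL₁ : ∀ p, L₁ p = 0 := by
      obtain ⟨t, ht1, ht2, ht3⟩ := exists_monic_vanishing S
      refine LinearMap.eq_zero_of_forall_X_pow_of_monic (m := 2 * s + 3) (fun i hi => ?_) ht1
        (by rw [ht2, hcard]) (ht t ht1 ht2 ht3)
      -- The untwisted powers up to `x^(s+1)` have products that reach every `x^i` with `i ≤ 2 s + 2
      -- = k - 1`.
      have := h _ (hpow (min i (s + 1)) (by omega)) _ (hpow (i - min i (s + 1)) (by omega))
      simpa [mulFst, mulSnd, ← pow_add, Nat.add_sub_cancel' (min_le_left i (s + 1))] using this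
    refine ⟨hL₁, fun j hj => ?_⟩
    -- For exponent `s` this pair carries the twist `η x^(s+2)`, which only contributes a value of
    -- `L₁`, already zero.
    have hy : oddTwist s η (0, X ^ min j s) ∈ degreeLTMap (oddTwist s η) (s + 2) (s + 1) :=
      mem_degreeLTMap.2 ⟨0, X ^ min j s, zero_degree_lt _, degree_X_pow_lt (by omega), rfl⟩
    have := h _ (hpow (j - min j s) (by omega)) _ hy
    rw [hL₁, zero_add, oddTwist_apply] at this
    simpa [mulSnd, ← pow_add, Nat.sub_add_cancel (min_le_left j s)] using this

theorem isSelfDualCode_tgecc_even [CharP K 2] {S : Finset K}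
    (hS : ∀ α ∈ S, ∃ Q : E.Point, Q.x = α) (s : ℕ) {P : Fin (2 * (2 * s + 4)) → E.Point}
    (hP : Function.Injective P) (hD : ∀ Q : E.Point, Q ∈ Set.range P ↔ Q.x ∈ S)
    {η : K} (hη : η ≠ 0) {v : Fin (2 * (2 * s + 4)) → K} (hv : ∀ i, v i ≠ 0) :
    IsSelfDualCode (tgecc P (2 * s + 4) (s + 2) η v) ↔
      ∃ c : K, c ≠ 0 ∧ ∀ i, v i ^ 2 = c * gammaRes S (P i) := by
  have hcard : S.card = 2 * s + 4 := by
    have := length_eq_two_mul_card hS hP hD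
    omega
  rw [tgecc_even]
  refine isSelfDualCode_image_iff hS hP hD (by omega) hv _ ?_ ?_ ?_ ?_
  · intro m hm
    obtain ⟨h1, h2, -⟩ := bounds_evenTwist hm
    rw [hcard]
    exact ⟨degree_lt_of_natDegree_le h1 (by omega), degree_lt_of_natDegree_le h2 (by omega)⟩
  · rw [finrank_degreeLTMap (evenTwist_injective s η), hcard]
    ring
  · intro m hm m' hm'
    obtain ⟨h1, h2, h3⟩ := bounds_evenTwist hm
    obtain ⟨h1', h2', h3'⟩ := bounds_evenTwist hm'
    have := mulSnd_degree_lt_and_coeff_eq (by omega) h1 h2 h1' h2' h3 h3' (Or.inl one_ne_zero)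
    rw [hcard]
    convert this using 3 <;> omega
  · intro L₁ L₂ ht h
    have hpow : ∀ i < s + 2, ((X ^ i, 0) : K[X] × K[X]) ∈
        degreeLTMap (evenTwist s η) (s + 3) (s + 1) := fun i hi =>
      mem_degreeLTMap.2 ⟨X ^ i, 0, degree_X_pow_lt (hi.trans (Nat.lt_succ_self _)),
        zero_degree_lt _, by simp [evenTwist_apply, coeff_X_pow, hi.ne']⟩
    have hypow : ∀ j < s + 1, ((0, X ^ j) : K[X] × K[X]) ∈
        degreeLTMap (evenTwist s η) (s + 3) (s + 1) := fun j hj =>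
      mem_degreeLTMap.2 ⟨0, X ^ j, zero_degree_lt _, degree_X_pow_lt hj, by
        simp [evenTwist_apply]⟩
    have hL₁' : ∀ i < 2 * s + 3, L₁ (X ^ i) = 0 := fun i hi => by
      have := h _ (hpow (min i (s + 1)) (by omega)) _ (hpow (i - min i (s + 1)) (by omega))
      simpa [mulFst, mulSnd, ← pow_add, Nat.add_sub_cancel' (min_le_left i (s + 1))] using this
    have hL₂' : ∀ j < 2 * s + 2, L₂ (X ^ j) = 0 := fun j hj => by
      have := h _ (hpow (j - min j s) (by omega)) _ (hypow (min j s) (by omega))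
      simpa [mulFst, mulSnd, ← pow_add, Nat.sub_add_cancel (min_le_left j s)] using this
    -- Untwisted powers only reach `x^(2s+2)`. The missing `x^(2s+3)` comes from `(x^s y)² = x^(2s)
    -- (f + y)`, as `f` has degree exactly `3`.
    have htop : L₁ (X ^ (2 * s + 3)) = 0 := by
      have h1 := h _ (hypow s (by omega)) _ (hypow s (by omega))
      have hf : (X ^ s * X ^ s * E.f : K[X])
          = X ^ (2 * s) * E.f.eraseLead + E.f.leadingCoeff • X ^ (2 * s + 3) := by
        nth_rw 1 [← E.f.eraseLead_add_C_mul_X_pow]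
        rw [E.natDegree_f, smul_eq_C_mul]
        ring
      have he : L₁ (X ^ (2 * s) * E.f.eraseLead) = 0 := by
        refine LinearMap.eq_zero_of_forall_X_pow hL₁' (degree_lt_of_natDegree_le (n := 2 * s + 2)
          (natDegree_mul_le_of_le (natDegree_X_pow_le _) ?_) (by omega))
        have := E.f.eraseLead_natDegree_le
        rwa [E.natDegree_f] at this
      have h2 : L₂ (mulSnd ((0, X ^ s) : K[X] × K[X]) (0, X ^ s)) = 0 := by
        simpa [mulSnd, ← pow_add] using hL₂' (s + s) (by omega)
      rw [h2, add_zero, mulFst, zero_mul, zero_add, hf, map_add, he, zero_add, map_smul,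
        smul_eq_mul] at h1
      refine (mul_eq_zero.1 h1).resolve_left (leadingCoeff_ne_zero.2 fun h0 => ?_)
      simpa [h0] using E.natDegree_f
    have hL₁ : ∀ p, L₁ p = 0 := by
      obtain ⟨t, ht1, ht2, ht3⟩ := exists_monic_vanishing S
      refine LinearMap.eq_zero_of_forall_X_pow_of_monic (m := 2 * s + 4) (fun i hi => ?_) ht1
        (by rw [ht2, hcard]) (ht t ht1 ht2 ht3)
      rcases (Nat.lt_succ_iff.1 hi).lt_or_eq with h' | rfl
      · exact hL₁' i h'
      · exact htop
    refine ⟨hL₁, fun j hj => ?_⟩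
    have hj' : j < 2 * s + 3 := by omega
    rcases (Nat.lt_succ_iff.1 hj').lt_or_eq with h' | rfl
    · exact hL₂' j h'
    -- The last moment, of `x^(2s+2) y`, appears only with the factor `η`, in `x^(s+1) (x^(s+2) + η
    -- x^(s+1) y)`; here `η ≠ 0` is essential.
    · have hT : evenTwist s η (X ^ (s + 2), 0) ∈ degreeLTMap (evenTwist s η) (s + 3) (s + 1) :=
        mem_degreeLTMap.2 ⟨X ^ (s + 2), 0, degree_X_pow_lt (by omega), zero_degree_lt _, rfl⟩
      have h1 := h _ (hpow (s + 1) (by omega)) _ hT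
      have e : mulSnd ((X ^ (s + 1), 0) : K[X] × K[X]) (evenTwist s η (X ^ (s + 2), 0))
          = η • X ^ (2 * s + 2) := by
        rw [evenTwist_apply, mulSnd, smul_eq_C_mul]
        simp only [coeff_X_pow_self, one_mul, zero_add, zero_mul, mul_zero, add_zero]
        ring
      rw [hL₁, zero_add, e, map_smul, smul_eq_mul] at h1
      exact (mul_eq_zero.1 h1).resolve_left hη

end SecondTypeCurve

end

theorem mainTheorem8 {K : Type*} [Field K] [Finite K] [CharP K 2]
    (E : SecondTypeCurve K) (k : ℕ) (hk : 3 ≤ k)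
    (S : Finset K) (hS : ∀ α ∈ S, ∃ Q : E.Point, Q.x = α)
    (P : Fin (2 * k) → E.Point) (hP : Function.Injective P)
    (hD : ∀ Q : E.Point, Q ∈ Set.range P ↔ Q.x ∈ S)
    (η : K) (hη : η ≠ 0) (v : Fin (2 * k) → K) (hv : ∀ i, v i ≠ 0) :
    (Odd k →
      (IsSelfDualCode (SecondTypeCurve.tgecc P k ((k - 3) / 2) η v) ↔
        (∑ i, SecondTypeCurve.gammaRes S (P i) * (P i).x ^ (k + 1) = 0) ∧
          ∃ c : K, c ≠ 0 ∧ ∀ i, v i ^ 2 = c * SecondTypeCurve.gammaRes S (P i))) ∧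
    (Even k →
      (IsSelfDualCode (SecondTypeCurve.tgecc P k (k / 2) η v) ↔
        (∑ i, SecondTypeCurve.gammaRes S (P i) * (P i).x ^ (k - 2) * (P i).y ^ 2 = 0) ∧
          ∃ c : K, c ≠ 0 ∧ ∀ i, v i ^ 2 = c * SecondTypeCurve.gammaRes S (P i))) := by
  have hcard : S.card = k := by
    have := SecondTypeCurve.length_eq_two_mul_card hS hP hD
    omega
  constructor
  · intro hodd
    -- A function of `x` alone takes equal values at conjugate points, so its weighted sum vanishes.
    have hsum : ∑ i, SecondTypeCurve.gammaRes S (P i) * (P i).x ^ (k + 1) = 0 := by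
      have := SecondTypeCurve.sum_gammaRes_mul_eval hS hP hD (X ^ (k + 1)) (B := 0)
        (SecondTypeCurve.zero_degree_lt _)
      simpa using this
    rw [and_iff_right hsum]
    obtain ⟨s, rfl⟩ : ∃ s, k = 2 * s + 3 := by
      obtain ⟨r, rfl⟩ := hodd
      exact ⟨r - 1, by omega⟩
    have e : (2 * s + 3 - 3) / 2 = s := by omega
    rw [e]
    exact SecondTypeCurve.isSelfDualCode_tgecc_odd hS s hP hD η hv
  · intro heven
    -- Replacing `y²` by `f + y` leaves `x^(k-2)` as the coefficient of `y`, and this has no term in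
    -- `x^(k-1)`.
    have hsum : ∑ i, SecondTypeCurve.gammaRes S (P i) * (P i).x ^ (k - 2) * (P i).y ^ 2 = 0 := by
      have hB : (X ^ (k - 2) : K[X]).degree < S.card :=
        SecondTypeCurve.degree_X_pow_lt (by omega)
      have h := SecondTypeCurve.sum_gammaRes_mul_eval hS hP hD (X ^ (k - 2) * E.f) hB
      rw [coeff_X_pow, if_neg (by omega)] at h
      rw [← h]
      refine Finset.sum_congr rfl fun i _ => ?_
      have h2 : (2 : K) = 0 := CharTwo.two_eq_zero
      rw [eval_mul, eval_pow, eval_X]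
      linear_combination SecondTypeCurve.gammaRes S (P i) * (P i).x ^ (k - 2) *
        ((P i).equation - (P i).y * h2)
    rw [and_iff_right hsum]
    obtain ⟨s, rfl⟩ : ∃ s, k = 2 * s + 4 := by
      obtain ⟨r, rfl⟩ := heven
      exact ⟨r - 2, by omega⟩
    have e : (2 * s + 4) / 2 = s + 2 := by omega
    rw [e]
    exact SecondTypeCurve.isSelfDualCode_tgecc_even hS s hP hD hη hv
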